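/- Let $\rho\in\mathbb R$ and $\mathbb H_\rho=\{s\in\mathbb C:\Re(s)>\rho\}$. Let $\mathbf a=(a_{m,n})_{m,n\ge 1}$ be a matrix of complex numbers such that the double Dirichlet series $\sum_{m,n\ge1}a_{m,n}m^{-s}n^{-u}$ is regularly convergent at every $(s,u)\in\mathbb H_\rho\times\mathbb H_\rho$; that is, its rectangular partial sums $\sum_{m\le M,\,n\le N}$ converge as $M,N\to\infty$ independently, and all the series $\sum_m a_{m,n}m^{-s}$ $(n\ge1)$ and $\sum_n a_{m,n}n^{-u}$ $(m\ge1)$ converge. Let $$\kappa_{\mathbf a}(s,u)=\sum_{m,n\ge1}a_{m,n}m^{-s}n^{-\bar u},\qquad s,u\in\mathbb H_\rho,$$ be the corresponding Dirichlet series kernel. Let $\mathrm{Aut}(\mathbb H_\rho)$ be the group of biholomorphic self-maps of $\mathbb H_\rho$, and let $\mathrm{Aut}_L(\mathbb H_\rho)$ be its subgroup of maps $s\mapsto \frac{a(s-\rho)-ib}{d}+\rho$ with $a,b,d\in\mathbb R$, $ad=1$. For a group $G$ acting on $\mathbb H_\rho$ and a nowhere-vanishing function $\mathcal J:G\times\mathbb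 H_\rho\to\mathbb C$ with $\mathcal J(g,\cdot)$ holomorphic for every $g\in G$, a kernel $\kappa$ on $\mathbb H_\rho$ is called $G$-quasi-invariant with respect to $\mathcal J$ if $\kappa$ is positive semi-definite and $$\mathcal J(g,s)\,\kappa(g\cdot s,g\cdot u)\,\overline{\mathcal J(g,u)}=\kappa(s,u)\qquad (s,u\in\mathbb H_\rho,\ g\in G).$$ If $\kappa_{\mathbf a}$ is positive semi-definite, $\mathscr H_{\mathbf a}$ denotes the reproducing kernel Hilbert space with reproducing kernel $\kappa_{\mathbf a}$. A Dirichlet series on $\mathbb H_\rho$ is a function $f(s)=\sum_{n\ge1}c_n n^{-s}$ whose series converges at every point of $\mathbb H_\rho$. Then the following statements are equivalent: - (i) $\kappa_{\mathbf a}$ is $\mathrm{Aut}(\mathbb H_\rho)$-quasi-invariant with respect to some $\mathcal J$; - (ii) $\kappa_{\mathbf a}$ is $\mathrm{Aut}_L(\mathbb H_\rho)$-quasi-invariant with respect to some $\mathcal J$; - (iii) there is a Dirichlet series $f$ on $\mathbb H_\rho$, either identically zero or nowhere vanishing on $\mathbb H_\rho$, such that $\kappa_{\mathbf a}(s,u)=f(s)\overline{f(u)}$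 for all $s,u\in\mathbb H_\rho$; - (iv) $\kappa_{\mathbf a}$ is positive semi-definite, and $\mathscr H_{\mathbf a}$ is either $\{0\}$ or spanned by one nowhere-vanishing Dirichlet series on $\mathbb H_\rho$. In particular, if $\kappa_{\mathbf a}$ is $\mathrm{Aut}(\mathbb H_\rho)$-quasi-invariant with respect to some $\mathcal J$, then $\dim\mathscr H_{\mathbf a}\le1$. -/

import Mathlib

open Filter Topology ComplexConjugate
open scoped ComplexOrder MatrixGroups

noncomputable section

namespace DirichletKernel

/-- The open right half-plane of complex numbers with real part larger than `ρ`. -/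
def halfPlane (ρ : ℝ) : Set ℂ := {s | ρ < s.re}

/-! ### Dirichlet series in one and two variables

Coefficients are indexed by the positive integers: values at the index `0` are never used. -/

/-- The partial sum over `1 ≤ n ≤ N` of the Dirichlet series with coefficients `c`. -/
def partialSum (c : ℕ → ℂ) (s : ℂ) (N : ℕ) : ℂ :=
  ∑ n ∈ Finset.Icc 1 N, c n * (n : ℂ) ^ (-s)

/-- The rectangular partial sum over `1 ≤ m ≤ M` and `1 ≤ n ≤ N` of the double Dirichlet series
with coefficients `a`. -/
def doublePartialSum (a : ℕ → ℕ → ℂ) (s u : ℂ) (P : ℕ × ℕ) : ℂ :=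
  ∑ m ∈ Finset.Icc 1 P.1, ∑ n ∈ Finset.Icc 1 P.2, a m n * (m : ℂ) ^ (-s) * (n : ℂ) ^ (-u)

/-- Hardy's regular convergence at `(s, u)`: the rectangular partial sums converge when both
bounds tend to infinity independently, and every column series and every row series converges. -/
structure RegularlyConvergentAt (a : ℕ → ℕ → ℂ) (s u : ℂ) : Prop where
  double : ∃ l : ℂ, Tendsto (doublePartialSum a s u) atTop (𝓝 l)
  column : ∀ n : ℕ, 1 ≤ n → ∃ l : ℂ, Tendsto (partialSum (fun m ↦ a m n) s) atTop (𝓝 l)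
  row : ∀ m : ℕ, 1 ≤ m → ∃ l : ℂ, Tendsto (partialSum (fun n ↦ a m n) u) atTop (𝓝 l)

/-- The matrix `a` is the coefficient matrix of a Dirichlet series kernel on the half-plane of
abscissa `ρ`: the double Dirichlet series is regularly convergent at every point of the product
of the half-plane with itself. -/
def IsCoefficientMatrix (ρ : ℝ) (a : ℕ → ℕ → ℂ) : Prop :=
  ∀ s ∈ halfPlane ρ, ∀ u ∈ halfPlane ρ, RegularlyConvergentAt a s u

/-- The kernel `κ(s, u) = ∑ a m n * m ^ (-s) * n ^ (-conj u)`, the limit of the rectangular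
partial sums. -/
def kernel (ρ : ℝ) (a : ℕ → ℕ → ℂ) (s u : halfPlane ρ) : ℂ :=
  limUnder atTop (doublePartialSum a s (conj (u : ℂ)))

/-- The function `f` on the half-plane is the sum of a Dirichlet series that converges at every
point of the half-plane. -/
def IsDirichletSeries (ρ : ℝ) (f : halfPlane ρ → ℂ) : Prop :=
  ∃ c : ℕ → ℂ, ∀ s : halfPlane ρ, Tendsto (partialSum c s) atTop (𝓝 (f s))

/-! ### Positive semi-definite kernels and their reproducing kernel Hilbert spaces -/

/-- A kernel on `X` is positive semi-definite if it is Hermitian and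
`∑ i, ∑ j, conj (c i) * κ i j * c j ≥ 0` for all finitely supported `c`. -/
def PosSemidefKernel {X : Type*} (κ : X → X → ℂ) : Prop :=
  (Matrix.of κ).PosSemidef

/-- A scalar kernel as a kernel of (multiplication) operators on the Hilbert space `ℂ`. -/
def operatorKernel {X : Type*} (κ : X → X → ℂ) : Matrix X X (ℂ →L[ℂ] ℂ) :=
  Matrix.of fun x y ↦ κ x y • 1

theorem posSemidef_operatorKernel {X : Type*} {κ : X → X → ℂ} (h : PosSemidefKernel κ) :
    (operatorKernel κ).PosSemidef := by
  have hK : (operatorKernel κ).IsHermitian := by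
    ext x y
    have hxy : conj (κ y x) = κ x y := h.isHermitian.apply x y
    rw [Matrix.conjTranspose_apply]
    simp [operatorKernel, hxy]
  refine ((RKHS.posSemidef_tfae (K := operatorKernel κ)).out 0 2).mpr ?_
  refine ⟨hK, fun v ↦ ?_⟩
  have hv := (Complex.le_def.mp (h.2 v)).1
  refine hv.trans_eq (congrArg Complex.re ?_)
  refine Finsupp.sum_congr fun x _ ↦ Finsupp.sum_congr fun y _ ↦ ?_
  have hxy : conj (κ y x) = κ x y := h.isHermitian.apply x y
  simp [operatorKernel, hxy]
  ring

instance fact_posSemidef_operatorKernel {X : Type*} {κ : X → X → ℂ} [h : Fact (PosSemidefKernel κ)] :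
    Fact (operatorKernel κ).PosSemidef :=
  ⟨posSemidef_operatorKernel h.out⟩

/-- The reproducing kernel Hilbert space associated with a positive semi-definite kernel. -/
abbrev HilbertSpace {X : Type*} (κ : X → X → ℂ) [Fact (PosSemidefKernel κ)] : Type _ :=
  RKHS.OfKernel (operatorKernel κ)

/-- The associated space is a Hilbert space of functions on `X` whose reproducing kernel is `κ`. -/
theorem inner_kerFun {X : Type*} (κ : X → X → ℂ) [Fact (PosSemidefKernel κ)]
    (f : HilbertSpace κ) (t : X) :
    inner ℂ (RKHS.kerFun (HilbertSpace κ) t 1) f = f t ∧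
      ∀ s, RKHS.kerFun (HilbertSpace κ) t 1 s = κ s t := by
  refine ⟨by simp, fun s ↦ ?_⟩
  rw [RKHS.kerFun_apply, RKHS.OfKernel.kernel_ofKernel]
  simp [operatorKernel]

/-! ### Automorphisms and quasi-invariance -/

/-- Holomorphy of a function defined on an open set only. -/
def IsHolomorphic {Ω : Set ℂ} (f : Ω → ℂ) : Prop :=
  ∃ F : ℂ → ℂ, DifferentiableOn ℂ F Ω ∧ ∀ z : Ω, F z = f z

theorem IsHolomorphic.comp {Ω : Set ℂ} {f : Ω → ℂ} {g : Ω → Ω} (hf : IsHolomorphic f)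
    (hg : IsHolomorphic fun z ↦ (g z : ℂ)) : IsHolomorphic fun z ↦ f (g z) := by
  obtain ⟨F, hF, hFf⟩ := hf
  obtain ⟨G, hG, hGg⟩ := hg
  refine ⟨F ∘ G, hF.comp hG fun z hz ↦ ?_, fun z ↦ ?_⟩
  · rw [hGg ⟨z, hz⟩]
    exact (g ⟨z, hz⟩).2
  · rw [Function.comp_apply, hGg, hFf]

/-- The automorphism group of a domain: its biholomorphic self-maps, acting by evaluation. -/
def automorphismGroup (Ω : Set ℂ) : Subgroup (Equiv.Perm Ω) where
  carrier := {e | (IsHolomorphic fun z ↦ (e z : ℂ)) ∧ IsHolomorphic fun z ↦ (e.symm z : ℂ)}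
  mul_mem' := fun {e g} he hg ↦
    ⟨IsHolomorphic.comp (f := fun z ↦ (e z : ℂ)) he.1 hg.1,
      IsHolomorphic.comp (f := fun z ↦ (g.symm z : ℂ)) hg.2 he.2⟩
  one_mem' := ⟨⟨id, differentiableOn_id, fun _ ↦ rfl⟩, ⟨id, differentiableOn_id, fun _ ↦ rfl⟩⟩
  inv_mem' := fun {_} he ↦ ⟨he.2, he.1⟩

/-- The linear fractional map of the half-plane of abscissa `ρ` given by a real matrix. -/
def mobius (ρ : ℝ) (A : SL(2, ℝ)) (s : ℂ) : ℂ :=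
  ((A 0 0 : ℝ) * (s - ρ) - Complex.I * (A 0 1 : ℝ)) /
    (Complex.I * (A 1 0 : ℝ) * (s - ρ) + (A 1 1 : ℝ)) + ρ

theorem upper_triangular_det {A : SL(2, ℝ)} (hA : A 1 0 = 0) : A 0 0 * A 1 1 = 1 := by
  have h := A.2
  rw [Matrix.det_fin_two] at h
  simpa [hA] using h

/-- The subgroup of linear automorphisms of the half-plane of abscissa `ρ`: those given by an
upper triangular matrix. -/
def linearAutomorphismGroup (ρ : ℝ) : Subgroup (automorphismGroup (halfPlane ρ)) where
  carrier := {g | ∃ A : SL(2, ℝ), A 1 0 = 0 ∧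
    ∀ s : halfPlane ρ, ((g • s : halfPlane ρ) : ℂ) = mobius ρ A s}
  mul_mem' := by
    rintro g h ⟨A, hA, hgA⟩ ⟨B, hB, hhB⟩
    have h1 := upper_triangular_det hA
    have h2 := upper_triangular_det hB
    have e1 : (A * B) 0 0 = A 0 0 * B 0 0 := by
      simp [Matrix.mul_apply, Fin.sum_univ_two, hB]
    have e2 : (A * B) 0 1 = A 0 0 * B 0 1 + A 0 1 * B 1 1 := by
      simp [Matrix.mul_apply, Fin.sum_univ_two]
    have e3 : (A * B) 1 0 = 0 := by
      simp [Matrix.mul_apply, Fin.sum_univ_two, hA, hB]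
    have e4 : (A * B) 1 1 = A 1 1 * B 1 1 := by
      simp [Matrix.mul_apply, Fin.sum_univ_two, hA]
    refine ⟨A * B, e3, fun s ↦ ?_⟩
    have h3 : ((A 1 1 : ℝ) : ℂ) ≠ 0 := by
      exact_mod_cast right_ne_zero_of_mul_eq_one h1
    have h4 : ((B 1 1 : ℝ) : ℂ) ≠ 0 := by
      exact_mod_cast right_ne_zero_of_mul_eq_one h2
    rw [mul_smul, hgA, hhB, mobius, mobius, mobius, e1, e2, e3, e4, hA, hB]
    push_cast
    simp only [mul_zero, zero_mul, zero_add]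
    field_simp
    ring
  one_mem' := ⟨1, by simp, fun s ↦ by simp [mobius]⟩
  inv_mem' := by
    rintro g ⟨A, hA, hgA⟩
    have h1 := upper_triangular_det hA
    have h3 : ((A 1 1 : ℝ) : ℂ) ≠ 0 := by
      exact_mod_cast right_ne_zero_of_mul_eq_one h1
    have h4 : ((A 0 0 : ℝ) : ℂ) ≠ 0 := by
      exact_mod_cast left_ne_zero_of_mul_eq_one h1
    have e : (A⁻¹ : SL(2, ℝ)).1 = !![A 1 1, -A 0 1; -A 1 0, A 0 0] := by
      rw [Matrix.SpecialLinearGroup.coe_inv, Matrix.adjugate_fin_two]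
    have e1 : A⁻¹ 0 0 = A 1 1 := congrFun (congrFun e 0) 0
    have e2 : A⁻¹ 0 1 = -A 0 1 := congrFun (congrFun e 0) 1
    have e3 : A⁻¹ 1 0 = -A 1 0 := congrFun (congrFun e 1) 0
    have e4 : A⁻¹ 1 1 = A 0 0 := congrFun (congrFun e 1) 1
    refine ⟨A⁻¹, by rw [e3, hA, neg_zero], fun s ↦ ?_⟩
    have h5 := hgA (g⁻¹ • s)
    rw [smul_inv_smul, mobius, hA] at h5
    rw [mobius, e1, e2, e3, e4, hA, h5]
    push_cast
    simp only [mul_zero, zero_mul, zero_add, neg_zero]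
    field_simp
    ring

/-- The kernel `κ` is positive semi-definite and quasi-invariant under the group `G` with respect
to the multiplier `J`, which is nowhere zero and holomorphic in its second variable. -/
structure IsQuasiInvariant {Ω : Set ℂ} (G : Type*) [Group G] [MulAction G Ω] (J : G → Ω → ℂ)
    (κ : Ω → Ω → ℂ) : Prop where
  posSemidef : PosSemidefKernel κ
  ne_zero : ∀ g s, J g s ≠ 0
  holomorphic : ∀ g, IsHolomorphic (J g)
  transform : ∀ g s u, J g s * κ (g • s) (g • u) * conj (J g u) = κ s u

end DirichletKernel

end

noncomputable section

namespace DirichletKernel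

/-! The substance is (ii) ⇒ (iii), and it uses only the dilations `s ↦ ρ + r (s - ρ)`.
Quasi-invariance makes the quotient `|κ(s,u)|² / (κ(s,s) κ(u,u))` invariant, because the multipliers
cancel. As `r → ∞` the dilated points move to infinite real part, where a double Dirichlet series is
governed by its leading term. If that term is a diagonal one, `a_{K,K} K^{-s} K^{-conj u}`, the
kernel is asymptotically of rank one and the quotient tends to 1. Hence it equals 1 everywhere:
equality holds in Cauchy-Schwarz, all kernel functions are proportional, and `κ(s,u) = f(s) conj
f(u)` with `f` a normalized kernel function (`IsCoefficientMatrix.exists_eq_mul_conj`).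

That the leading term is diagonal comes from positivity
(`IsCoefficientMatrix.exists_leading_coeff`): Hermitian symmetry makes the first nonzero row and
column have the same index, and Cauchy-Schwarz forbids a zero at the corner. The asymptotics are
`IsCoefficientMatrix.tendsto_leading_coeff`.

For (iii) ⇒ (i) the multiplier is `f(s) / f(g s)`, holomorphic since convergent Dirichlet series
are. The equivalence of (iii) and (iv) describes spaces with a rank-one kernel. -/

theorem isOpen_halfPlane (ρ : ℝ) : IsOpen (halfPlane ρ) :=
  isOpen_lt continuous_const Complex.continuous_re

/-! ### Convergent Dirichlet series are holomorphic -/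

@[simp]
theorem partialSum_zero (c : ℕ → ℂ) (s : ℂ) : partialSum c s 0 = 0 := by
  simp [partialSum]

theorem partialSum_succ (c : ℕ → ℂ) (s : ℂ) (N : ℕ) :
    partialSum c s (N + 1) = partialSum c s N + c (N + 1) * ((N + 1 : ℕ) : ℂ) ^ (-s) := by
  rw [partialSum, Finset.sum_Icc_succ_top (by omega), partialSum]

/-- Abel summation for the partial sums of a Dirichlet series. -/
theorem partialSum_add (c : ℕ → ℂ) (s w : ℂ) (N : ℕ) :
    partialSum c (s + w) N = partialSum c s N * (N : ℂ) ^ (-w) +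
      ∑ n ∈ Finset.range N,
        partialSum c s n * ((n : ℂ) ^ (-w) - ((n + 1 : ℕ) : ℂ) ^ (-w)) := by
  induction N with
  | zero => simp
  | succ N ih =>
    have h : ((N + 1 : ℕ) : ℂ) ≠ 0 := Nat.cast_ne_zero.mpr N.succ_ne_zero
    rw [partialSum_succ, ih, Finset.sum_range_succ, partialSum_succ c s, neg_add,
      Complex.cpow_add _ _ h]
    ring

/-- Mean value inequality for `y ↦ y ^ (-w)` on `[n, n + 1]`. For `w.re > 0` the bound is summable
in `n`, which makes the Abel-summed series converge absolutely. -/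
theorem norm_natCast_cpow_sub_succ_le {n : ℕ} (hn : n ≠ 0) {w : ℂ} (hw : 0 ≤ w.re) :
    ‖(n : ℂ) ^ (-w) - ((n + 1 : ℕ) : ℂ) ^ (-w)‖ ≤ ‖w‖ * (n : ℝ) ^ (-w.re - 1) := by
  have hn0 : (0 : ℝ) < n := by positivity
  have hpos : ∀ x ∈ Set.Icc (n : ℝ) (n + 1), 0 < x := fun x hx ↦ hn0.trans_le hx.1
  have hder : ∀ x ∈ Set.Icc (n : ℝ) (n + 1),
      HasDerivWithinAt (fun y : ℝ ↦ (y : ℂ) ^ (-w)) (-w * (x : ℂ) ^ (-w - 1))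
        (Set.Icc (n : ℝ) (n + 1)) x := by
    intro x hx
    have h := (hasDerivAt_id (x : ℂ)).cpow_const (c := -w)
      (Complex.ofReal_mem_slitPlane.mpr (hpos x hx))
    simpa using h.comp_ofReal.hasDerivWithinAt
  have hbound : ∀ x ∈ Set.Icc (n : ℝ) (n + 1),
      ‖-w * (x : ℂ) ^ (-w - 1)‖ ≤ ‖w‖ * (n : ℝ) ^ (-w.re - 1) := by
    intro x hx
    rw [norm_mul, norm_neg, Complex.norm_cpow_eq_rpow_re_of_pos (hpos x hx)]
    gcongr
    simpa using Real.rpow_le_rpow_of_nonpos hn0 hx.1 (by linarith : -w.re - 1 ≤ 0)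
  have h := (convex_Icc (n : ℝ) (n + 1)).norm_image_sub_le_of_norm_hasDerivWithin_le (𝕜 := ℝ)
    hder hbound (x := (n : ℝ) + 1) (y := n) (by simp) (by simp)
  simpa using h

theorem tendsto_natCast_cpow_neg {w : ℂ} (hw : 0 < w.re) :
    Tendsto (fun N : ℕ ↦ (N : ℂ) ^ (-w)) atTop (𝓝 0) := by
  rw [tendsto_zero_iff_norm_tendsto_zero]
  refine ((tendsto_rpow_neg_atTop hw).comp tendsto_natCast_atTop_atTop).congr' ?_
  filter_upwards [eventually_gt_atTop 0] with N hN
  simp [Complex.norm_natCast_cpow_of_pos hN]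

/-- A Dirichlet series converging on the half-plane is holomorphic there. -/
theorem IsDirichletSeries.isHolomorphic {ρ : ℝ} {f : halfPlane ρ → ℂ}
    (hf : IsDirichletSeries ρ f) : IsHolomorphic f := by
  classical
  obtain ⟨c, hc⟩ := hf
  refine ⟨fun z ↦ if h : z ∈ halfPlane ρ then f ⟨z, h⟩ else 0, fun z hz ↦ ?_, fun z ↦ by simp⟩
  have hz' : ρ < z.re := hz
  -- The point `z` has real part `ρ + 4δ` and the auxiliary point `s` has `ρ + 2δ`, so `z - s` has
  -- real part `2δ` and lies inside `U`.
  set δ : ℝ := (z.re - ρ) / 4 with hδ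
  have hδ0 : 0 < δ := by rw [hδ]; linarith
  set s : ℂ := ((ρ + 2 * δ : ℝ) : ℂ) with hs
  have hsre : s.re = ρ + 2 * δ := by simp [hs]
  have hsmem : s ∈ halfPlane ρ := by change ρ < s.re; linarith
  obtain ⟨C, hC⟩ := (hc ⟨s, hsmem⟩).norm.bddAbove_range
  have hC' : ∀ n, ‖partialSum c s n‖ ≤ C := fun n ↦ hC ⟨n, rfl⟩
  have hC0 : 0 ≤ C := (norm_nonneg _).trans (hC' 0)
  set R : ℝ := ‖z - s‖ + 1 with hR
  set U : Set ℂ := {w | δ < w.re ∧ ‖w‖ < R} with hU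
  have hUo : IsOpen U := (isOpen_lt continuous_const Complex.continuous_re).inter
    (isOpen_lt continuous_norm continuous_const)
  have hzU : z - s ∈ U := ⟨by rw [Complex.sub_re, hsre]; linarith, by rw [hR]; linarith⟩
  let F : ℕ → ℂ → ℂ := fun n w ↦
    partialSum c s n * ((n : ℂ) ^ (-w) - ((n + 1 : ℕ) : ℂ) ^ (-w))
  have hFle : ∀ n, ∀ w ∈ U, ‖F n w‖ ≤ C * (R * (n : ℝ) ^ (-δ - 1)) := by
    rintro n w ⟨hw1, hw2⟩
    have hR0 : 0 ≤ R := (norm_nonneg w).trans hw2.le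
    -- The empty partial sum kills the term `n = 0`, so the exceptional behaviour of `0 ^ (-w)` does
    -- no harm.
    rcases eq_or_ne n 0 with rfl | hn
    · simp only [F, partialSum_zero, zero_mul, norm_zero]
      positivity
    rw [norm_mul]
    refine mul_le_mul (hC' n) ?_ (norm_nonneg _) hC0
    refine (norm_natCast_cpow_sub_succ_le hn (hδ0.trans hw1).le).trans ?_
    have h1 : (1 : ℝ) ≤ n := by exact_mod_cast Nat.one_le_iff_ne_zero.mpr hn
    gcongr
  have hsum : Summable fun n : ℕ ↦ C * (R * (n : ℝ) ^ (-δ - 1)) :=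
    ((Real.summable_nat_rpow.mpr (by linarith)).mul_left R).mul_left C
  have hFd : ∀ n, DifferentiableOn ℂ (F n) U := by
    intro n
    rcases eq_or_ne n 0 with rfl | hn
    · simp only [F, partialSum_zero, zero_mul]
      exact differentiableOn_const 0
    have hn1 : ((n + 1 : ℕ) : ℂ) ≠ 0 := Nat.cast_ne_zero.mpr n.succ_ne_zero
    have hn0 : (n : ℂ) ≠ 0 := Nat.cast_ne_zero.mpr hn
    exact (((differentiable_neg.const_cpow (Or.inl hn0)).sub
      (differentiable_neg.const_cpow (Or.inl hn1))).const_mul _).differentiableOn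
  have hd : DifferentiableAt ℂ (fun w ↦ ∑' n, F n w) (z - s) :=
    (Complex.differentiableOn_tsum_of_summable_norm hsum hFd hUo hFle).differentiableAt
      (hUo.mem_nhds hzU)
  have hd' : DifferentiableAt ℂ (fun y ↦ ∑' n, F n (y - s)) z :=
    DifferentiableAt.comp z (g := fun w ↦ ∑' n, F n w) hd (by fun_prop)
  refine (hd'.congr_of_eventuallyEq ?_).differentiableWithinAt
  have hnhds : ∀ᶠ y in 𝓝 z, y - s ∈ U :=
    (continuous_id.sub continuous_const).continuousAt.eventually (hUo.mem_nhds hzU)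
  filter_upwards [hnhds, (isOpen_halfPlane ρ).mem_nhds hz] with y hyU hy
  rw [dif_pos hy]
  refine tendsto_nhds_unique (hc ⟨y, hy⟩) ?_
  have h1 := (Summable.of_norm_bounded hsum fun n ↦ hFle n _ hyU).hasSum.tendsto_sum_nat
  -- The boundary term of Abel summation tends to zero, leaving only the series of the `F n`.
  have h2 := ((hc ⟨s, hsmem⟩).mul (tendsto_natCast_cpow_neg (hδ0.trans hyU.1))).add h1
  rw [mul_zero, zero_add] at h2
  refine h2.congr fun N ↦ ?_
  have h3 := partialSum_add c s (y - s) N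
  rw [add_sub_cancel] at h3
  exact h3.symm

/-! ### Coefficients of convergent Dirichlet series -/

/-- Each term is a difference of two consecutive partial sums, and these are bounded. -/
theorem exists_norm_le_of_partialSum_tendsto {c : ℕ → ℂ} {s l : ℂ}
    (h : Tendsto (partialSum c s) atTop (𝓝 l)) :
    ∃ C, ∀ n ≠ 0, ‖c n‖ ≤ C * (n : ℝ) ^ s.re := by
  obtain ⟨C, hC⟩ := h.norm.bddAbove_range
  have hC' : ∀ n, ‖partialSum c s n‖ ≤ C := fun n ↦ hC ⟨n, rfl⟩
  refine ⟨C + C, fun n hn ↦ ?_⟩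
  obtain ⟨n, rfl⟩ := Nat.exists_eq_succ_of_ne_zero hn
  have h0 : (0 : ℝ) < (n + 1 : ℕ) := by positivity
  have h1 := norm_sub_le (partialSum c s (n + 1)) (partialSum c s n)
  rw [partialSum_succ, add_sub_cancel_left, norm_mul,
    Complex.norm_natCast_cpow_of_pos n.succ_pos, Complex.neg_re, Real.rpow_neg h0.le,
    ← div_eq_mul_inv, div_le_iff₀ (Real.rpow_pos_of_pos h0 _), ← partialSum_succ] at h1
  refine h1.trans ?_
  gcongr <;> exact hC' _

theorem abscissaOfAbsConv_lt_top {c : ℕ → ℂ} {s l : ℂ}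
    (h : Tendsto (partialSum c s) atTop (𝓝 l)) : LSeries.abscissaOfAbsConv c < ⊤ := by
  obtain ⟨C, hC⟩ := exists_norm_le_of_partialSum_tendsto h
  have h1 : LSeriesSummable c ((s.re + 2 : ℝ) : ℂ) :=
    LSeriesSummable_of_le_const_mul_rpow (x := s.re + 1) (by simp)
      ⟨C, by simpa using hC⟩
  exact h1.abscissaOfAbsConv_le.trans_lt (EReal.coe_lt_top _)

theorem sum_range_term (c : ℕ → ℂ) (s : ℂ) (N : ℕ) :
    ∑ n ∈ Finset.range (N + 1), LSeries.term c s n = partialSum c s N := by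
  induction N with
  | zero => simp
  | succ N ih =>
    rw [Finset.sum_range_succ, ih, partialSum_succ, LSeries.term_of_ne_zero N.succ_ne_zero,
      Complex.cpow_neg, div_eq_mul_inv]

/-- `LSeries` is an unconditional sum, so it is compared with the conditionally convergent one only
for `x > ρ + 2`, where the polynomial bound on the coefficients gives absolute convergence. -/
theorem eventually_eq_LSeries {ρ : ℝ} {c : ℕ → ℂ} {f : ℂ → ℂ}
    (h : ∀ s ∈ halfPlane ρ, Tendsto (partialSum c s) atTop (𝓝 (f s))) :
    (fun x : ℝ ↦ LSeries c x) =ᶠ[atTop] fun x ↦ f x := by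
  have hmem : ((ρ + 1 : ℝ) : ℂ) ∈ halfPlane ρ := by simp [halfPlane]
  obtain ⟨C, hC⟩ := exists_norm_le_of_partialSum_tendsto (h _ hmem)
  filter_upwards [eventually_gt_atTop ρ, eventually_gt_atTop (ρ + 2)] with x hx hx2
  have h1 : LSeriesSummable c (x : ℂ) :=
    LSeriesSummable_of_le_const_mul_rpow (x := ρ + 2) (by simpa using hx2)
      ⟨C, fun n hn ↦ by simpa [show ρ + 2 - 1 = ρ + 1 by ring] using hC n hn⟩
  have h2 := (h1.LSeriesHasSum.tendsto_sum_nat).comp (tendsto_add_atTop_nat 1)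
  exact tendsto_nhds_unique (h2.congr fun N ↦ sum_range_term c x N)
    (h x (by simpa [halfPlane] using hx))

/-- A function has at most one expansion as a Dirichlet series on a half-plane. -/
theorem coeff_eq_of_tendsto {ρ : ℝ} {c d : ℕ → ℂ} {f : ℂ → ℂ}
    (hc : ∀ s ∈ halfPlane ρ, Tendsto (partialSum c s) atTop (𝓝 (f s)))
    (hd : ∀ s ∈ halfPlane ρ, Tendsto (partialSum d s) atTop (𝓝 (f s))) {n : ℕ} (hn : n ≠ 0) :
    c n = d n := by
  have hmem : ((ρ + 1 : ℝ) : ℂ) ∈ halfPlane ρ := by simp [halfPlane]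
  exact LSeries.eq_of_LSeries_eventually_eq (abscissaOfAbsConv_lt_top (hc _ hmem))
    (abscissaOfAbsConv_lt_top (hd _ hmem))
    ((eventually_eq_LSeries hc).trans (eventually_eq_LSeries hd).symm) hn

/-- The leading coefficient of a Dirichlet series is its normalized limit at `+∞`. -/
theorem tendsto_cpow_mul_leading_coeff {ρ : ℝ} {c : ℕ → ℂ} {f : ℂ → ℂ}
    (hc : ∀ s ∈ halfPlane ρ, Tendsto (partialSum c s) atTop (𝓝 (f s))) {k : ℕ}
    (h0 : ∀ n, 1 ≤ n → n ≤ k → c n = 0) :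
    Tendsto (fun x : ℝ ↦ ((k + 1 : ℕ) : ℂ) ^ (x : ℂ) * f x) atTop (𝓝 (c (k + 1))) := by
  have hmem : ((ρ + 1 : ℝ) : ℂ) ∈ halfPlane ρ := by simp [halfPlane]
  -- The value `c 0` is arbitrary, but `LSeries.tendsto_cpow_mul_atTop` needs vanishing at all
  -- indices up to `k`, including `0`.
  let d : ℕ → ℂ := fun n ↦ if n = 0 then 0 else c n
  have hcd : ∀ {n : ℕ}, n ≠ 0 → d n = c n := fun hn ↦ if_neg hn
  have hd0 : ∀ m ≤ k, d m = 0 := by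
    intro m hm
    rcases eq_or_ne m 0 with rfl | hm0
    · simp [d]
    · rw [hcd hm0, h0 m (by omega) hm]
  have h1 : LSeries.abscissaOfAbsConv d < ⊤ := by
    rw [LSeries.abscissaOfAbsConv_congr hcd]
    exact abscissaOfAbsConv_lt_top (hc _ hmem)
  have h2 := LSeries.tendsto_cpow_mul_atTop hd0 h1
  rw [hcd k.succ_ne_zero] at h2
  refine h2.congr' ?_
  filter_upwards [eventually_eq_LSeries hc] with x hx
  rw [LSeries_congr hcd, hx, Nat.cast_succ]

/-! ### Kernels and their reproducing kernel Hilbert spaces -/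

section RKHS

variable {X : Type*} {κ : X → X → ℂ}

theorem PosSemidefKernel.conj_apply (h : PosSemidefKernel κ) (s t : X) :
    conj (κ t s) = κ s t :=
  h.isHermitian.apply s t

/-- The kernel function at a point, as an element of the reproducing kernel Hilbert space. -/
def kernelFunction (κ : X → X → ℂ) [Fact (PosSemidefKernel κ)] (t : X) : HilbertSpace κ :=
  RKHS.kerFun (HilbertSpace κ) t 1

variable [Fact (PosSemidefKernel κ)]

theorem inner_kernelFunction (f : HilbertSpace κ) (t : X) :
    inner ℂ (kernelFunction κ t) f = f t :=
  (inner_kerFun κ f t).1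

theorem kernelFunction_apply (s t : X) : kernelFunction κ t s = κ s t :=
  (inner_kerFun κ 0 t).2 s

theorem inner_kernelFunction_kernelFunction (s t : X) :
    inner ℂ (kernelFunction κ s) (kernelFunction κ t) = κ s t := by
  rw [inner_kernelFunction, kernelFunction_apply]

end RKHS

theorem PosSemidefKernel.apply_self {X : Type*} {κ : X → X → ℂ} (h : PosSemidefKernel κ) (s : X) :
    κ s s = (‖κ s s‖ : ℝ) := by
  have : Fact (PosSemidefKernel κ) := ⟨h⟩
  rw [← inner_kernelFunction_kernelFunction (κ := κ), inner_self_eq_norm_sq_to_K]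
  simp

theorem PosSemidefKernel.norm_sq_le {X : Type*} {κ : X → X → ℂ} (h : PosSemidefKernel κ)
    (s t : X) : ‖κ s t‖ ^ 2 ≤ ‖κ s s‖ * ‖κ t t‖ := by
  have : Fact (PosSemidefKernel κ) := ⟨h⟩
  have h1 := norm_inner_le_norm (𝕜 := ℂ) (kernelFunction κ s) (kernelFunction κ t)
  simp only [← inner_kernelFunction_kernelFunction (κ := κ), inner_self_eq_norm_sq_to_K]
  simp only [norm_pow, RCLike.norm_ofReal, abs_norm]
  rw [← mul_pow]
  gcongr

/-- Equality in the Cauchy-Schwarz inequality at all pairs of points with one point fixed makes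
a positive semi-definite kernel factor through its kernel function at that point. -/
theorem PosSemidefKernel.mul_eq_of_norm_sq_eq {X : Type*} {κ : X → X → ℂ}
    (h : PosSemidefKernel κ) {o : X} {t : X}
    (heq : ‖κ t o‖ ^ 2 = ‖κ t t‖ * ‖κ o o‖) (s : X) : κ s t * κ o o = κ s o * κ o t := by
  have : Fact (PosSemidefKernel κ) := ⟨h⟩
  -- When `κ o o ≠ 0`, this is `κ o o` times the component of `kernelFunction κ t` orthogonal to
  -- `kernelFunction κ o`; equality in Cauchy-Schwarz makes its norm vanish.
  have hv : κ o o • kernelFunction κ t - κ o t • kernelFunction κ o = 0 := by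
    rw [← inner_self_eq_zero (𝕜 := ℂ)]
    simp only [inner_sub_left, inner_sub_right, inner_smul_left, inner_smul_right,
      inner_kernelFunction_kernelFunction, h.conj_apply]
    have h1 : κ t o * κ o t = κ t t * κ o o := by
      rw [h.apply_self t, h.apply_self o, ← h.conj_apply o t, Complex.mul_conj,
        ← Complex.ofReal_mul, ← heq, Complex.normSq_eq_norm_sq]
    linear_combination (-κ o o) * h1
  have h2 := congrArg (inner ℂ (kernelFunction κ s)) hv
  simp only [inner_sub_right, inner_smul_right, inner_kernelFunction_kernelFunction,
    inner_zero_right] at h2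
  linear_combination h2

/-- Kernels of rank at most one are positive semi-definite. -/
theorem posSemidefKernel_of_eq_mul_conj {X : Type*} {κ : X → X → ℂ} {f : X → ℂ}
    (h : ∀ s t, κ s t = f s * conj (f t)) : PosSemidefKernel κ := by
  refine ⟨?_, fun c ↦ ?_⟩
  · ext s t
    simp [Matrix.conjTranspose_apply, h, mul_comm]
  · have h1 : (c.sum fun i xi ↦ c.sum fun j xj ↦ star xi * Matrix.of κ i j * xj) =
        conj (c.sum fun i xi ↦ xi * conj (f i)) * (c.sum fun i xi ↦ xi * conj (f i)) := by
      simp only [Finsupp.sum, map_sum, Finset.sum_mul_sum]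
      refine Finset.sum_congr rfl fun i _ ↦ Finset.sum_congr rfl fun j _ ↦ ?_
      simp [h]
      ring
    rw [h1]
    exact star_mul_self_nonneg _

/-! ### Reproducing kernel Hilbert spaces of dimension at most one -/

section RankOne

variable {X : Type*} {κ : X → X → ℂ} [Fact (PosSemidefKernel κ)]

theorem eq_zero_of_kernel_eq_zero (h : ∀ s t, κ s t = 0) (g : HilbertSpace κ) : g = 0 := by
  refine RKHS.ext fun t ↦ ?_
  have h1 : kernelFunction κ t = 0 := by
    rw [← inner_self_eq_zero (𝕜 := ℂ), inner_kernelFunction_kernelFunction, h]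
  rw [← inner_kernelFunction, h1, inner_zero_left, RKHS.coe_zero, Pi.zero_apply]

/-- The function `f` belongs to the space as a multiple of the kernel function at `o`. Every kernel
function is then a multiple of it, so the reproducing property gives `g t = ⟪F, g⟫ * f t`. -/
theorem exists_span_eq_top {f : X → ℂ} (h : ∀ s t, κ s t = f s * conj (f t)) {o : X}
    (ho : f o ≠ 0) : ∃ F : HilbertSpace κ, ⇑F = f ∧ Submodule.span ℂ {F} = ⊤ := by
  have ho' : conj (f o) ≠ 0 := (map_ne_zero _).mpr ho
  have hF : ⇑((conj (f o))⁻¹ • kernelFunction κ o) = f := by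
    ext s
    rw [RKHS.coe_smul, Pi.smul_apply, kernelFunction_apply, h, smul_eq_mul]
    field_simp
  refine ⟨_, hF, ?_⟩
  generalize (conj (f o))⁻¹ • kernelFunction κ o = F at hF
  have hk : ∀ t, kernelFunction κ t = conj (f t) • F := by
    intro t
    refine RKHS.ext fun s ↦ ?_
    rw [RKHS.coe_smul, Pi.smul_apply, kernelFunction_apply, h, hF, smul_eq_mul, mul_comm]
  rw [eq_top_iff]
  rintro g -
  refine Submodule.mem_span_singleton.mpr ⟨inner ℂ F g, RKHS.ext fun t ↦ ?_⟩
  rw [RKHS.coe_smul, Pi.smul_apply, hF, ← inner_kernelFunction g, hk, inner_smul_left]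
  simp [mul_comm]

theorem kernel_eq_zero_of_forall_eq_zero (h : ∀ g : HilbertSpace κ, g = 0) (s t : X) :
    κ s t = 0 := by
  rw [← inner_kernelFunction_kernelFunction (κ := κ), h (kernelFunction κ t), inner_zero_right]

/-- The kernel function at `t` is `c • F`, and pairing it with `F` determines `c`; this is the
expansion of the kernel in the orthonormal basis `F / ‖F‖`. -/
theorem kernel_eq_of_span_eq_top {F : HilbertSpace κ} (h : Submodule.span ℂ {F} = ⊤)
    (hF : F ≠ 0) (s t : X) : κ s t = ((‖F‖ : ℂ)⁻¹ * F s) * conj ((‖F‖ : ℂ)⁻¹ * F t) := by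
  obtain ⟨c, hc⟩ := Submodule.mem_span_singleton.mp
    (h ▸ Submodule.mem_top : kernelFunction κ t ∈ Submodule.span ℂ {F})
  have hF' : (‖F‖ : ℂ) ≠ 0 := by simpa using hF
  have h1 : F t = conj c * (‖F‖ : ℂ) ^ 2 := by
    rw [← inner_kernelFunction F t, ← hc, inner_smul_left, inner_self_eq_norm_sq_to_K]
    rfl
  rw [← kernelFunction_apply (κ := κ), ← hc, RKHS.coe_smul, Pi.smul_apply, h1]
  simp
  field_simp

end RankOne

/-! ### Regularly convergent double Dirichlet series -/

theorem conj_mem_halfPlane {ρ : ℝ} {s : ℂ} (hs : s ∈ halfPlane ρ) : conj s ∈ halfPlane ρ := by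
  simpa [halfPlane] using hs

theorem tendsto_of_tendsto_prod {f : ℕ × ℕ → ℂ} {g : ℕ → ℂ} {l : ℂ}
    (hf : Tendsto f atTop (𝓝 l)) (hg : ∀ M, Tendsto (fun N ↦ f (M, N)) atTop (𝓝 (g M))) :
    Tendsto g atTop (𝓝 l) := by
  rw [Metric.tendsto_atTop] at hf ⊢
  intro ε hε
  obtain ⟨⟨M₀, N₀⟩, h⟩ := hf (ε / 2) (by linarith)
  refine ⟨M₀, fun M hM ↦ ?_⟩
  have h1 : dist (g M) l ≤ ε / 2 := by
    refine le_of_tendsto ((hg M).dist tendsto_const_nhds) ?_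
    filter_upwards [eventually_ge_atTop N₀] with N hN
    exact (h (M, N) ⟨hM, hN⟩).le
  linarith

theorem doublePartialSum_eq_sum_partialSum (a : ℕ → ℕ → ℂ) (s u : ℂ) (P : ℕ × ℕ) :
    doublePartialSum a s u P =
      ∑ m ∈ Finset.Icc 1 P.1, partialSum (a m) u P.2 * (m : ℂ) ^ (-s) := by
  refine Finset.sum_congr rfl fun m _ ↦ ?_
  rw [partialSum, Finset.sum_mul]
  exact Finset.sum_congr rfl fun n _ ↦ by ring

theorem doublePartialSum_transpose (a : ℕ → ℕ → ℂ) (s u : ℂ) (P : ℕ × ℕ) :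
    doublePartialSum (fun m n ↦ a n m) s u P = doublePartialSum a u s P.swap := by
  rw [doublePartialSum, doublePartialSum, Finset.sum_comm]
  exact Finset.sum_congr rfl fun m _ ↦ Finset.sum_congr rfl fun n _ ↦ by ring

theorem natCast_cpow_conj (n : ℕ) (s : ℂ) : conj ((n : ℂ) ^ s) = (n : ℂ) ^ conj s := by
  rw [Complex.cpow_conj _ _ (by simp [Complex.natCast_arg, Real.pi_ne_zero.symm]),
    Complex.conj_natCast]

theorem partialSum_conj (c : ℕ → ℂ) (s : ℂ) (N : ℕ) :
    partialSum (fun n ↦ conj (c n)) s N = conj (partialSum c (conj s) N) := by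
  simp [partialSum, map_sum, natCast_cpow_conj]

theorem doublePartialSum_conjTranspose (a : ℕ → ℕ → ℂ) (s u : ℂ) (P : ℕ × ℕ) :
    doublePartialSum (fun m n ↦ conj (a n m)) s u P =
      conj (doublePartialSum a (conj u) (conj s) P.swap) := by
  rw [← doublePartialSum_transpose a (conj s) (conj u)]
  simp [doublePartialSum, map_sum, natCast_cpow_conj]

theorem tendsto_swap_atTop : Tendsto (Prod.swap : ℕ × ℕ → ℕ × ℕ) atTop atTop := by
  rw [← prod_atTop_atTop_eq]
  exact tendsto_snd.prodMk tendsto_fst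

/-- The sum of a convergent double Dirichlet series. -/
def doubleSum (a : ℕ → ℕ → ℂ) (s u : ℂ) : ℂ :=
  limUnder atTop (doublePartialSum a s u)

/-- The sum of a row of a double Dirichlet series. -/
def rowSum (a : ℕ → ℕ → ℂ) (u : ℂ) (m : ℕ) : ℂ :=
  limUnder atTop (partialSum (a m) u)

theorem kernel_eq_doubleSum (ρ : ℝ) (a : ℕ → ℕ → ℂ) (s u : halfPlane ρ) :
    kernel ρ a s u = doubleSum a s (conj (u : ℂ)) := rfl

section Regular

variable {a : ℕ → ℕ → ℂ} {s u : ℂ}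

theorem RegularlyConvergentAt.tendsto_doubleSum (h : RegularlyConvergentAt a s u) :
    Tendsto (doublePartialSum a s u) atTop (𝓝 (doubleSum a s u)) :=
  tendsto_nhds_limUnder h.double

theorem RegularlyConvergentAt.tendsto_rowSum (h : RegularlyConvergentAt a s u) {m : ℕ}
    (hm : 1 ≤ m) : Tendsto (partialSum (a m) u) atTop (𝓝 (rowSum a u m)) :=
  tendsto_nhds_limUnder (h.row m hm)

theorem RegularlyConvergentAt.tendsto_doublePartialSum_right (h : RegularlyConvergentAt a s u)
    (M : ℕ) : Tendsto (fun N ↦ doublePartialSum a s u (M, N)) atTop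
      (𝓝 (partialSum (rowSum a u) s M)) := by
  simp only [doublePartialSum_eq_sum_partialSum]
  exact tendsto_finsetSum _ fun m hm ↦
    (h.tendsto_rowSum (Finset.mem_Icc.mp hm).1).mul_const _

/-- A double Dirichlet series may be summed row by row. -/
theorem RegularlyConvergentAt.tendsto_partialSum_rowSum (h : RegularlyConvergentAt a s u) :
    Tendsto (partialSum (rowSum a u) s) atTop (𝓝 (doubleSum a s u)) :=
  tendsto_of_tendsto_prod h.tendsto_doubleSum h.tendsto_doublePartialSum_right

theorem RegularlyConvergentAt.transpose (h : RegularlyConvergentAt a s u) :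
    RegularlyConvergentAt (fun m n ↦ a n m) u s where
  double := ⟨_, (h.tendsto_doubleSum.comp tendsto_swap_atTop).congr fun P ↦
    (doublePartialSum_transpose a u s P).symm⟩
  column := h.row
  row := h.column

/-- Serves to carry Hermitian symmetry from the kernel to its coefficients. -/
theorem RegularlyConvergentAt.conjTranspose (h : RegularlyConvergentAt a (conj u) (conj s)) :
    RegularlyConvergentAt (fun m n ↦ conj (a n m)) s u where
  double := ⟨_, ((h.tendsto_doubleSum.comp tendsto_swap_atTop).star).congr fun P ↦
    (doublePartialSum_conjTranspose a s u P).symm⟩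
  column n hn := by
    obtain ⟨l, hl⟩ := h.row n hn
    exact ⟨_, hl.star.congr fun N ↦ (partialSum_conj (a n) s N).symm⟩
  row n hn := by
    obtain ⟨l, hl⟩ := h.column n hn
    exact ⟨_, hl.star.congr fun N ↦ (partialSum_conj (fun m ↦ a m n) u N).symm⟩

theorem RegularlyConvergentAt.doubleSum_conjTranspose
    (h : RegularlyConvergentAt a (conj u) (conj s)) :
    doubleSum (fun m n ↦ conj (a n m)) s u = conj (doubleSum a (conj u) (conj s)) :=
  tendsto_nhds_unique h.conjTranspose.tendsto_doubleSum
    (((h.tendsto_doubleSum.comp tendsto_swap_atTop).star).congr fun P ↦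
      (doublePartialSum_conjTranspose a s u P).symm)

/-- Convergence of the rectangular sums controls only a quadrant `M ≥ M₀`, `N ≥ N₀`. The finitely
many remaining rows and columns are bounded because each converges, which is where regular
convergence enters. -/
theorem RegularlyConvergentAt.exists_norm_doublePartialSum_le
    (h : RegularlyConvergentAt a s u) : ∃ C, ∀ P, ‖doublePartialSum a s u P‖ ≤ C := by
  have hrow : ∀ M, ∃ C, ∀ N, ‖doublePartialSum a s u (M, N)‖ ≤ C := fun M ↦ by
    obtain ⟨C, hC⟩ := (h.tendsto_doublePartialSum_right M).norm.bddAbove_range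
    exact ⟨C, fun N ↦ hC ⟨N, rfl⟩⟩
  have hcol : ∀ N, ∃ C, ∀ M, ‖doublePartialSum a s u (M, N)‖ ≤ C := fun N ↦ by
    obtain ⟨C, hC⟩ := (h.transpose.tendsto_doublePartialSum_right N).norm.bddAbove_range
    refine ⟨C, fun M ↦ ?_⟩
    have h1 : ‖doublePartialSum (fun m n ↦ a n m) u s (N, M)‖ ≤ C := hC ⟨M, rfl⟩
    rwa [doublePartialSum_transpose] at h1
  choose C hC using hrow
  choose D hD using hcol
  obtain ⟨⟨M₀, N₀⟩, h₀⟩ := Metric.tendsto_atTop.mp h.tendsto_doubleSum 1 one_pos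
  have hC0 : ∀ M, 0 ≤ C M := fun M ↦ (norm_nonneg _).trans (hC M 0)
  have hD0 : ∀ N, 0 ≤ D N := fun N ↦ (norm_nonneg _).trans (hD N 0)
  have hCs : 0 ≤ ∑ M ∈ Finset.range M₀, C M := Finset.sum_nonneg fun M _ ↦ hC0 M
  have hDs : 0 ≤ ∑ N ∈ Finset.range N₀, D N := Finset.sum_nonneg fun N _ ↦ hD0 N
  have hl := norm_nonneg (doubleSum a s u)
  refine ⟨‖doubleSum a s u‖ + 1 + ∑ M ∈ Finset.range M₀, C M + ∑ N ∈ Finset.range N₀, D N,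
    fun ⟨M, N⟩ ↦ ?_⟩
  rcases lt_or_ge M M₀ with hM | hM
  · have h1 := Finset.single_le_sum (fun M _ ↦ hC0 M) (Finset.mem_range.mpr hM)
    linarith [hC M N]
  rcases lt_or_ge N N₀ with hN | hN
  · have h1 := Finset.single_le_sum (fun N _ ↦ hD0 N) (Finset.mem_range.mpr hN)
    linarith [hD N M]
  have h1 := h₀ (M, N) ⟨hM, hN⟩
  rw [dist_eq_norm] at h1
  have h2 := norm_sub_norm_le (doublePartialSum a s u (M, N)) (doubleSum a s u)
  linarith

theorem doublePartialSum_succ_succ_sub (a : ℕ → ℕ → ℂ) (s u : ℂ) (m n : ℕ) :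
    doublePartialSum a s u (m + 1, n + 1) - doublePartialSum a s u (m, n + 1) -
        (doublePartialSum a s u (m + 1, n) - doublePartialSum a s u (m, n)) =
      a (m + 1) (n + 1) * ((m + 1 : ℕ) : ℂ) ^ (-s) * ((n + 1 : ℕ) : ℂ) ^ (-u) := by
  simp only [doublePartialSum_eq_sum_partialSum, Finset.sum_Icc_succ_top (Nat.le_add_left 1 m),
    partialSum_succ]
  ring

/-- A single term is a mixed second difference of four bounded rectangular sums, whence the factor
4. -/
theorem RegularlyConvergentAt.exists_norm_coeff_le (h : RegularlyConvergentAt a s u) :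
    ∃ C, ∀ m n : ℕ, ‖a (m + 1) (n + 1)‖ ≤
      C * ((m + 1 : ℕ) : ℝ) ^ s.re * ((n + 1 : ℕ) : ℝ) ^ u.re := by
  obtain ⟨C, hC⟩ := h.exists_norm_doublePartialSum_le
  refine ⟨4 * C, fun m n ↦ ?_⟩
  have hm : (0 : ℝ) < (m + 1 : ℕ) := by positivity
  have hn : (0 : ℝ) < (n + 1 : ℕ) := by positivity
  have h1 : ‖a (m + 1) (n + 1) * ((m + 1 : ℕ) : ℂ) ^ (-s) * ((n + 1 : ℕ) : ℂ) ^ (-u)‖ ≤ 4 * C := by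
    rw [← doublePartialSum_succ_succ_sub]
    refine (norm_sub_le _ _).trans ?_
    have h2 := norm_sub_le (doublePartialSum a s u (m + 1, n + 1))
      (doublePartialSum a s u (m, n + 1))
    have h3 := norm_sub_le (doublePartialSum a s u (m + 1, n)) (doublePartialSum a s u (m, n))
    linarith [hC (m + 1, n + 1), hC (m, n + 1), hC (m + 1, n), hC (m, n)]
  rw [norm_mul, norm_mul, Complex.norm_natCast_cpow_of_pos m.succ_pos,
    Complex.norm_natCast_cpow_of_pos n.succ_pos, Complex.neg_re, Complex.neg_re,
    Real.rpow_neg hm.le, Real.rpow_neg hn.le, ← div_eq_mul_inv, ← div_eq_mul_inv,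
    div_le_iff₀ (by positivity), div_le_iff₀ (by positivity)] at h1
  linarith

end Regular

/-- Two matrices with the same double Dirichlet series have the same entries. -/
theorem IsCoefficientMatrix.coeff_eq {ρ : ℝ} {a b : ℕ → ℕ → ℂ} (ha : IsCoefficientMatrix ρ a)
    (hb : IsCoefficientMatrix ρ b)
    (hab : ∀ s ∈ halfPlane ρ, ∀ u ∈ halfPlane ρ, doubleSum a s u = doubleSum b s u) {m n : ℕ}
    (hm : m ≠ 0) (hn : n ≠ 0) : a m n = b m n := by
  have hrow : ∀ u ∈ halfPlane ρ, rowSum a u m = rowSum b u m := fun u hu ↦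
    coeff_eq_of_tendsto (f := fun s ↦ doubleSum a s u)
      (fun s hs ↦ (ha s hs u hu).tendsto_partialSum_rowSum)
      (fun s hs ↦ hab s hs u hu ▸ (hb s hs u hu).tendsto_partialSum_rowSum) hm
  have h1 : 1 ≤ m := Nat.one_le_iff_ne_zero.mpr hm
  exact coeff_eq_of_tendsto (f := fun u ↦ rowSum a u m)
    (fun u hu ↦ (ha u hu u hu).tendsto_rowSum h1)
    (fun u hu ↦ hrow u hu ▸ (hb u hu u hu).tendsto_rowSum h1) hn

/-- The kernel is Hermitian, so `a` and its conjugate transpose have the same double Dirichlet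
series, and uniqueness of coefficients applies. -/
theorem IsCoefficientMatrix.conj_coeff {ρ : ℝ} {a : ℕ → ℕ → ℂ} (ha : IsCoefficientMatrix ρ a)
    (hκ : PosSemidefKernel (kernel ρ a)) {m n : ℕ} (hm : m ≠ 0) (hn : n ≠ 0) :
    conj (a n m) = a m n := by
  have hreg : ∀ s ∈ halfPlane ρ, ∀ u ∈ halfPlane ρ,
      RegularlyConvergentAt a (conj u) (conj s) := fun s hs u hu ↦
    ha _ (conj_mem_halfPlane hu) _ (conj_mem_halfPlane hs)
  refine IsCoefficientMatrix.coeff_eq (ρ := ρ) (a := fun m n ↦ conj (a n m))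
    (fun s hs u hu ↦ (hreg s hs u hu).conjTranspose) ha (fun s hs u hu ↦ ?_) hm hn
  have h1 := hκ.conj_apply ⟨s, hs⟩ ⟨conj u, conj_mem_halfPlane hu⟩
  simp only [kernel_eq_doubleSum, Complex.conj_conj] at h1
  rw [(hreg s hs u hu).doubleSum_conjTranspose, h1]

/-! ### Leading behaviour -/

theorem tendsto_range_prod_range :
    Tendsto (fun P : ℕ × ℕ ↦ Finset.range P.1 ×ˢ Finset.range P.2) atTop atTop := by
  refine tendsto_atTop_finset_of_monotone (fun P Q hPQ ↦ ?_) fun x ↦ ⟨(x.1 + 1, x.2 + 1), by simp⟩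
  exact Finset.product_subset_product (Finset.range_subset_range.mpr hPQ.1)
    (Finset.range_subset_range.mpr hPQ.2)

theorem doublePartialSum_eq_sum_range (a : ℕ → ℕ → ℂ) (s u : ℂ) (P : ℕ × ℕ) :
    doublePartialSum a s u P = ∑ x ∈ Finset.range P.1 ×ˢ Finset.range P.2,
      a (x.1 + 1) (x.2 + 1) * ((x.1 + 1 : ℕ) : ℂ) ^ (-s) * ((x.2 + 1 : ℕ) : ℂ) ^ (-u) := by
  have h : ∀ (f : ℕ → ℂ) (N : ℕ), ∑ n ∈ Finset.Icc 1 N, f n = ∑ n ∈ Finset.range N, f (n + 1) :=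
    fun f N ↦ by
      induction N with
      | zero => simp
      | succ N ih => rw [Finset.sum_Icc_succ_top (by omega), ih, Finset.sum_range_succ]
  rw [Finset.sum_product, doublePartialSum, h]
  exact Finset.sum_congr rfl fun m _ ↦ h _ _

/-- The leading coefficient of a double Dirichlet series is its normalized limit when the real
parts of both variables tend to infinity. -/
theorem IsCoefficientMatrix.tendsto_leading_coeff {ρ : ℝ} {a : ℕ → ℕ → ℂ}
    (ha : IsCoefficientMatrix ρ a) {k : ℕ}
    (h0 : ∀ m n : ℕ, m < k ∨ n < k → a (m + 1) (n + 1) = 0) {ι : Type*} {l : Filter ι}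
    {s u : ι → ℂ} (hs : Tendsto (fun i ↦ (s i).re) l atTop)
    (hu : Tendsto (fun i ↦ (u i).re) l atTop) :
    Tendsto (fun i ↦ ((k + 1 : ℕ) : ℂ) ^ s i * ((k + 1 : ℕ) : ℂ) ^ u i * doubleSum a (s i) (u i))
      l (𝓝 (a (k + 1) (k + 1))) := by
  have hmem : ((ρ + 1 : ℝ) : ℂ) ∈ halfPlane ρ := by simp [halfPlane]
  obtain ⟨C, hC⟩ := (ha _ hmem _ hmem).exists_norm_coeff_le
  simp only [Complex.ofReal_re] at hC
  have hC0 : 0 ≤ C := by simpa using (norm_nonneg _).trans (hC 0 0)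
  let r : ℕ → ℝ := fun m ↦ ((k + 1 : ℕ) : ℝ) / ((m + 1 : ℕ) : ℝ)
  have hr0 : ∀ m, 0 < r m := fun m ↦ by positivity
  have hr1 : ∀ m, k ≤ m → r m ≤ 1 := fun m hm ↦ by
    rw [div_le_one (by positivity)]
    exact_mod_cast Nat.succ_le_succ hm
  let T : ι → ℕ × ℕ → ℂ := fun i x ↦ ((k + 1 : ℕ) : ℂ) ^ s i * ((k + 1 : ℕ) : ℂ) ^ u i *
    (a (x.1 + 1) (x.2 + 1) * ((x.1 + 1 : ℕ) : ℂ) ^ (-s i) * ((x.2 + 1 : ℕ) : ℂ) ^ (-u i))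
  have hT : ∀ i x, ‖T i x‖ = ‖a (x.1 + 1) (x.2 + 1)‖ * r x.1 ^ (s i).re * r x.2 ^ (u i).re := by
    intro i x
    simp only [T, r, norm_mul, Complex.norm_natCast_cpow_of_pos (Nat.succ_pos _), Complex.neg_re,
      Real.div_rpow (Nat.cast_nonneg _) (Nat.cast_nonneg _), Real.rpow_neg (Nat.cast_nonneg _)]
    ring
  -- Coefficients grow at most like the power `ρ + 1` in each index. Once both real parts are at
  -- least `ρ + 3`, the exponent `-2` remains and the majorant is summable.
  let B : ℕ × ℕ → ℝ := fun x ↦ C * (((k + 1 : ℕ) : ℝ) ^ (ρ + 3)) ^ 2 *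
    (((x.1 + 1 : ℕ) : ℝ) ^ (-2 : ℝ) * ((x.2 + 1 : ℕ) : ℝ) ^ (-2 : ℝ))
  have hB : Summable B := by
    have h1 : Summable fun n : ℕ ↦ ((n + 1 : ℕ) : ℝ) ^ (-2 : ℝ) :=
      (summable_nat_add_iff 1).mpr (Real.summable_nat_rpow.mpr (by norm_num))
    exact (h1.mul_of_nonneg h1 (fun n ↦ by positivity) fun n ↦ by positivity).mul_left _
  have hTB : ∀ i, ρ + 3 ≤ (s i).re → ρ + 3 ≤ (u i).re → ∀ x, ‖T i x‖ ≤ B x := by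
    rintro i hsi hui ⟨m, n⟩
    rw [hT]
    by_cases hx : m < k ∨ n < k
    · rw [h0 m n hx, norm_zero, zero_mul, zero_mul]
      positivity
    push Not at hx
    have hpow : ∀ j : ℕ, ((j + 1 : ℕ) : ℝ) ^ (ρ + 1) * r j ^ (ρ + 3) =
        ((k + 1 : ℕ) : ℝ) ^ (ρ + 3) * ((j + 1 : ℕ) : ℝ) ^ (-2 : ℝ) := by
      intro j
      have hj : (0 : ℝ) < (j + 1 : ℕ) := by positivity
      rw [Real.div_rpow (Nat.cast_nonneg _) hj.le, show (-2 : ℝ) = ρ + 1 - (ρ + 3) by ring,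
        Real.rpow_sub hj]
      ring
    calc ‖a (m + 1) (n + 1)‖ * r m ^ (s i).re * r n ^ (u i).re
        ≤ (C * ((m + 1 : ℕ) : ℝ) ^ (ρ + 1) * ((n + 1 : ℕ) : ℝ) ^ (ρ + 1)) * r m ^ (ρ + 3) *
          r n ^ (ρ + 3) := by
          have h1 := Real.rpow_le_rpow_of_exponent_ge (hr0 m) (hr1 m hx.1) hsi
          have h2 := Real.rpow_le_rpow_of_exponent_ge (hr0 n) (hr1 n hx.2) hui
          have h3 := (hr0 m).le
          have h4 := (hr0 n).le
          gcongr
          exact hC m n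
      _ = C * (((m + 1 : ℕ) : ℝ) ^ (ρ + 1) * r m ^ (ρ + 3)) *
          (((n + 1 : ℕ) : ℝ) ^ (ρ + 1) * r n ^ (ρ + 3)) := by ring
      _ = B (m, n) := by
          rw [hpow, hpow]
          ring
  have hlim : ∀ x, Tendsto (fun i ↦ T i x) l
      (𝓝 (if x = (k, k) then a (k + 1) (k + 1) else 0)) := by
    have hone : ∀ m v, Tendsto v l atTop → k ≤ m →
        Tendsto (fun i ↦ r m ^ (v i : ℝ)) l (𝓝 (if m = k then 1 else 0)) := by
      intro m v hv hm
      split_ifs with hmk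
      · have : r m = 1 := by rw [hmk]; exact div_self (by positivity)
        simp [this, tendsto_const_nhds]
      · refine (tendsto_rpow_atTop_of_base_lt_one _ (by linarith [hr0 m]) ?_).comp hv
        rw [div_lt_one (by positivity)]
        exact_mod_cast Nat.succ_lt_succ (lt_of_le_of_ne hm (Ne.symm hmk))
    rintro ⟨m, n⟩
    by_cases hx : m < k ∨ n < k
    · have h1 : (m, n) ≠ (k, k) := by
        rintro h
        obtain ⟨rfl, rfl⟩ := Prod.mk.inj h
        simp at hx
      simp [T, h0 m n hx, h1, tendsto_const_nhds]
    push Not at hx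
    split_ifs with hmn
    · obtain ⟨hm, hn⟩ := Prod.mk.inj hmn
      have h1 : ∀ z : ℂ, ((k + 1 : ℕ) : ℂ) ^ z ≠ 0 := fun z h ↦
        Nat.cast_ne_zero.mpr k.succ_ne_zero ((Complex.cpow_eq_zero_iff _ _).mp h).1
      refine tendsto_const_nhds.congr fun i ↦ ?_
      have h2 := h1 (s i)
      have h3 := h1 (u i)
      simp only [T, hm, hn, Complex.cpow_neg]
      field_simp
    · rw [tendsto_zero_iff_norm_tendsto_zero]
      simp only [hT]
      have h1 := ((hone m _ hs hx.1).const_mul ‖a (m + 1) (n + 1)‖).mul (hone n _ hu hx.2)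
      convert h1 using 2
      have : ¬ (m = k ∧ n = k) := fun h ↦ hmn (Prod.ext h.1 h.2)
      split_ifs <;> simp_all
  have hmain := tendsto_tsum_of_dominated_convergence hB hlim (by
    filter_upwards [hs.eventually_ge_atTop (ρ + 3), hu.eventually_ge_atTop (ρ + 3)] with i h1 h2
    exact hTB i h1 h2)
  rw [tsum_ite_eq] at hmain
  refine hmain.congr' ?_
  filter_upwards [hs.eventually_ge_atTop (ρ + 3), hu.eventually_ge_atTop (ρ + 3)] with i h1 h2
  have hreg := ha (s i) (by change ρ < _; linarith) (u i) (by change ρ < _; linarith)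
  -- By absolute convergence the unconditional sum is also the limit along rectangles, hence agrees
  -- with `doubleSum`.
  refine tendsto_nhds_unique
    ((Summable.of_norm_bounded hB (hTB i h1 h2)).hasSum.comp tendsto_range_prod_range) ?_
  refine (hreg.tendsto_doubleSum.const_mul _).congr fun P ↦ ?_
  rw [doublePartialSum_eq_sum_range, Finset.mul_sum]
  rfl

/-! ### Dilations and kernels of rank one -/

/-- The nonzero coefficient matrix of a positive semi-definite kernel starts with a nonzero
diagonal entry. -/
theorem IsCoefficientMatrix.exists_leading_coeff {ρ : ℝ} {a : ℕ → ℕ → ℂ}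
    (ha : IsCoefficientMatrix ρ a) (hκ : PosSemidefKernel (kernel ρ a))
    (hne : ∃ m n : ℕ, a (m + 1) (n + 1) ≠ 0) :
    ∃ k : ℕ, (∀ m n : ℕ, m < k ∨ n < k → a (m + 1) (n + 1) = 0) ∧ a (k + 1) (k + 1) ≠ 0 := by
  classical
  obtain ⟨n₀, hn₀⟩ := Nat.find_spec hne
  set k := Nat.find hne
  have hrow : ∀ m n : ℕ, m < k → a (m + 1) (n + 1) = 0 := fun m n hm ↦ by
    by_contra h
    exact Nat.find_min hne hm ⟨n, h⟩
  have h0 : ∀ m n : ℕ, m < k ∨ n < k → a (m + 1) (n + 1) = 0 := by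
    rintro m n (h | h)
    · exact hrow m n h
    · rw [← ha.conj_coeff hκ m.succ_ne_zero n.succ_ne_zero, hrow n m h, map_zero]
  refine ⟨k, h0, fun hzero ↦ hn₀ ?_⟩
  -- If the corner entry vanished, then `(k+1)^{2x} κ(x,x)` would tend to zero. By Cauchy-Schwarz so
  -- would `|(k+1)^x κ(x,v)|²`, whose limit is the squared modulus of this row sum; the whole row
  -- would be zero, contrary to the choice of `k`.
  have hrowSum : ∀ u ∈ halfPlane ρ, rowSum a u (k + 1) = 0 := by
    intro u hu
    have hmem : ((ρ + 1 : ℝ) : ℂ) ∈ halfPlane ρ := by simp [halfPlane]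
    have h1 := tendsto_cpow_mul_leading_coeff (k := k)
      (fun s hs ↦ (ha s hs u hu).tendsto_partialSum_rowSum) fun n hn hnk ↦ by
        obtain ⟨n, rfl⟩ := Nat.exists_eq_succ_of_ne_zero (Nat.one_le_iff_ne_zero.mp hn)
        refine tendsto_nhds_unique ((ha u hu u hu).tendsto_rowSum hn)
          (tendsto_const_nhds.congr fun N ↦ (Finset.sum_eq_zero fun j hj ↦ ?_).symm)
        obtain ⟨j, rfl⟩ := Nat.exists_eq_succ_of_ne_zero
          (Nat.one_le_iff_ne_zero.mp (Finset.mem_Icc.mp hj).1)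
        rw [hrow n j hnk, zero_mul]
    have h2 := ha.tendsto_leading_coeff h0 (l := atTop) (s := fun x : ℝ ↦ (x : ℂ))
      (u := fun x : ℝ ↦ (x : ℂ)) (by simpa using! tendsto_id) (by simpa using! tendsto_id)
    rw [hzero] at h2
    set v : halfPlane ρ := ⟨conj u, conj_mem_halfPlane hu⟩ with hv
    have h3 := h2.norm.mul_const ‖kernel ρ a v v‖
    rw [norm_zero, zero_mul] at h3
    have h4 : Tendsto (fun x : ℝ ↦ ‖((k + 1 : ℕ) : ℂ) ^ (x : ℂ) * doubleSum a x u‖ ^ 2) atTop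
        (𝓝 0) := by
      refine squeeze_zero' (Eventually.of_forall fun x ↦ by positivity) ?_ h3
      filter_upwards [eventually_gt_atTop ρ] with x hx
      have h5 := hκ.norm_sq_le ⟨x, by simpa [halfPlane] using hx⟩ v
      nth_rw 1 [kernel_eq_doubleSum] at h5
      nth_rw 1 [kernel_eq_doubleSum] at h5
      simp only [hv, Complex.conj_conj, Complex.conj_ofReal] at h5 ⊢
      rw [norm_mul, mul_pow, norm_mul, norm_mul, ← pow_two, mul_assoc]
      gcongr
    have h6 := tendsto_nhds_unique (h1.norm.pow 2) h4
    simpa using h6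
  refine coeff_eq_of_tendsto (ρ := ρ) (d := fun _ ↦ 0) (f := fun _ ↦ 0)
    (fun u hu ↦ hrowSum u hu ▸ (ha u hu u hu).tendsto_rowSum (Nat.le_add_left 1 k))
    (fun u _ ↦ tendsto_const_nhds.congr fun N ↦ by simp [partialSum]) n₀.succ_ne_zero

theorem kernel_eq_zero {ρ : ℝ} {a : ℕ → ℕ → ℂ} (h : ∀ m n : ℕ, a (m + 1) (n + 1) = 0)
    (s u : halfPlane ρ) : kernel ρ a s u = 0 := by
  refine Tendsto.limUnder_eq (tendsto_const_nhds.congr fun P ↦ ?_)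
  rw [doublePartialSum_eq_sum_range]
  exact (Finset.sum_eq_zero fun x _ ↦ by simp [h]).symm

theorem IsDirichletSeries.const_mul {ρ : ℝ} {f : halfPlane ρ → ℂ} (hf : IsDirichletSeries ρ f)
    (r : ℂ) : IsDirichletSeries ρ fun s ↦ r * f s := by
  obtain ⟨c, hc⟩ := hf
  refine ⟨fun n ↦ r * c n, fun s ↦ ((hc s).const_mul r).congr fun N ↦ ?_⟩
  simp [partialSum, Finset.mul_sum, mul_assoc]

theorem isDirichletSeries_zero (ρ : ℝ) : IsDirichletSeries ρ fun _ ↦ 0 :=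
  ⟨fun _ ↦ 0, fun s ↦ tendsto_const_nhds.congr fun N ↦ by simp [partialSum]⟩

theorem IsCoefficientMatrix.isDirichletSeries_kernel {ρ : ℝ} {a : ℕ → ℕ → ℂ}
    (ha : IsCoefficientMatrix ρ a) (u : halfPlane ρ) :
    IsDirichletSeries ρ fun s ↦ kernel ρ a s u :=
  ⟨rowSum a (conj (u : ℂ)), fun s ↦
    (ha s s.2 _ (conj_mem_halfPlane u.2)).tendsto_partialSum_rowSum⟩

/-- The dilation of the half-plane fixing the boundary point `ρ`. -/
def dilation (ρ : ℝ) {r : ℝ} (hr : 0 < r) (s : halfPlane ρ) : halfPlane ρ :=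
  ⟨ρ + r * (s - ρ), by
    have h : ρ < (s : ℂ).re := s.2
    simpa [halfPlane] using mul_pos hr (sub_pos.mpr h)⟩

theorem coe_dilation {ρ r : ℝ} (hr : 0 < r) (s : halfPlane ρ) :
    (dilation ρ hr s : ℂ) = ρ + r * (s - ρ) := rfl

/-- A positive semi-definite Dirichlet series kernel that is invariant under dilations up to
multipliers has rank at most one. -/
theorem IsCoefficientMatrix.exists_eq_mul_conj {ρ : ℝ} {a : ℕ → ℕ → ℂ}
    (ha : IsCoefficientMatrix ρ a) (hκ : PosSemidefKernel (kernel ρ a))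
    (hinv : ∀ (r : ℝ) (hr : 0 < r), ∃ J : halfPlane ρ → ℂ, (∀ s, J s ≠ 0) ∧ ∀ s u,
      J s * kernel ρ a (dilation ρ hr s) (dilation ρ hr u) * conj (J u) = kernel ρ a s u) :
    ∃ f : halfPlane ρ → ℂ, IsDirichletSeries ρ f ∧
      (∀ s u, kernel ρ a s u = f s * conj (f u)) ∧ ((∀ s, f s = 0) ∨ ∀ s, f s ≠ 0) := by
  by_cases hne : ∃ m n : ℕ, a (m + 1) (n + 1) ≠ 0
  swap
  · push Not at hne
    exact ⟨fun _ ↦ 0, isDirichletSeries_zero ρ, fun s u ↦ by simp [kernel_eq_zero hne],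
      Or.inl fun _ ↦ rfl⟩
  obtain ⟨k, h0, hk⟩ := ha.exists_leading_coeff hκ hne
  have hD : ∀ r : Set.Ioi (0 : ℝ), 0 < (r : ℝ) := fun r ↦ r.2
  let D : Set.Ioi (0 : ℝ) → halfPlane ρ → halfPlane ρ := fun r ↦ dilation ρ (hD r)
  have hinv' : ∀ r, ∃ J : halfPlane ρ → ℂ, (∀ s, J s ≠ 0) ∧ ∀ s u,
      J s * kernel ρ a (D r s) (D r u) * conj (J u) = kernel ρ a s u := fun r ↦ hinv r (hD r)
  choose J hJ0 hJ using hinv'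
  have hre : ∀ s : halfPlane ρ, Tendsto (fun r ↦ ((D r s : ℂ)).re) atTop atTop := by
    intro s
    have h1 : 0 < (s : ℂ).re - ρ := sub_pos.mpr s.2
    have h2 : Tendsto (fun r : Set.Ioi (0 : ℝ) ↦ (r : ℝ)) atTop atTop :=
      tendsto_atTop_mono' atTop (Eventually.of_forall fun r ↦ le_refl (r : ℝ))
        (tendsto_comp_val_Ioi_atTop.mpr tendsto_id)
    refine (tendsto_atTop_add_const_left _ ρ (h2.atTop_mul_const h1)).congr fun r ↦ ?_
    simp [D, coe_dilation]
  -- Normalizing factors that cancel the decay of the leading term. Each depends on one point only,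
  -- so they drop out of the Cauchy-Schwarz quotient just as the multipliers do.
  let q : Set.Ioi (0 : ℝ) → halfPlane ρ → ℝ := fun r s ↦ ‖((k + 1 : ℕ) : ℂ) ^ (D r s : ℂ)‖
  have hlim : ∀ s u, Tendsto (fun r ↦ q r s * q r u * ‖kernel ρ a (D r s) (D r u)‖) atTop
      (𝓝 ‖a (k + 1) (k + 1)‖) := by
    intro s u
    refine (ha.tendsto_leading_coeff h0 (hre s) (u := fun r ↦ conj (D r u : ℂ))
      (by simpa using hre u)).norm.congr fun r ↦ ?_
    rw [norm_mul, norm_mul, kernel_eq_doubleSum, ← natCast_cpow_conj, RCLike.norm_conj]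
  have hnorm : ∀ r s u, ‖kernel ρ a s u‖ = ‖J r s‖ * ‖kernel ρ a (D r s) (D r u)‖ * ‖J r u‖ := by
    intro r s u
    rw [← hJ r s u, norm_mul, norm_mul, RCLike.norm_conj]
  have hak : ‖a (k + 1) (k + 1)‖ ≠ 0 := norm_ne_zero_iff.mpr hk
  have heq : ∀ s u, ‖kernel ρ a s u‖ ^ 2 = ‖kernel ρ a s s‖ * ‖kernel ρ a u u‖ := by
    intro s u
    have h1 := ((hlim s s).mul (hlim u u)).const_mul (‖kernel ρ a s u‖ ^ 2)
    have h2 := ((hlim s u).mul (hlim s u)).const_mul (‖kernel ρ a s s‖ * ‖kernel ρ a u u‖)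
    -- Once `hnorm` is inserted, the two expressions agree for every `r`, so their limits agree.
    refine mul_right_cancel₀ (mul_ne_zero hak hak) (tendsto_nhds_unique h1 (h2.congr fun r ↦ ?_))
    rw [hnorm r s u, hnorm r s s, hnorm r u u]
    ring
  -- The diagonal is nonzero after a large dilation, and nowhere-vanishing multipliers carry this
  -- back to `s`.
  have hdiag : ∀ s, kernel ρ a s s ≠ 0 := by
    intro s
    obtain ⟨r, hr⟩ := ((hlim s s).eventually_ne hak).exists
    rw [← norm_ne_zero_iff, hnorm r s s]
    exact mul_ne_zero (mul_ne_zero (norm_ne_zero_iff.mpr (hJ0 r s)) (right_ne_zero_of_mul hr))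
      (norm_ne_zero_iff.mpr (hJ0 r s))
  let o : halfPlane ρ := ⟨((ρ + 1 : ℝ) : ℂ), by simp [halfPlane]⟩
  have ho : (0 : ℝ) < ‖kernel ρ a o o‖ := norm_pos_iff.mpr (hdiag o)
  have hsq : ((√‖kernel ρ a o o‖ : ℝ) : ℂ) ^ 2 = kernel ρ a o o := by
    rw [hκ.apply_self o, ← Complex.ofReal_pow, Real.sq_sqrt (norm_nonneg _)]
    simp
  have hf : ∀ s u, kernel ρ a s u = (((√‖kernel ρ a o o‖ : ℝ) : ℂ)⁻¹ * kernel ρ a s o) *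
      conj (((√‖kernel ρ a o o‖ : ℝ) : ℂ)⁻¹ * kernel ρ a u o) := by
    intro s u
    rw [map_mul, map_inv₀, Complex.conj_ofReal, hκ.conj_apply, mul_mul_mul_comm, ← mul_inv,
      ← pow_two, hsq, ← hκ.mul_eq_of_norm_sq_eq (heq u o) s]
    field_simp [hdiag o]
  refine ⟨_, (ha.isDirichletSeries_kernel o).const_mul _, hf, Or.inr fun s h ↦ hdiag s ?_⟩
  rw [hf, h, zero_mul]

/-! ### The automorphism groups -/

theorem isHolomorphic_dilation (ρ : ℝ) {r : ℝ} (hr : 0 < r) :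
    IsHolomorphic fun s ↦ (dilation ρ hr s : ℂ) :=
  ⟨fun s ↦ ρ + r * (s - ρ), by fun_prop, fun _ ↦ rfl⟩

/-- The dilation of the half-plane as an automorphism. -/
def dilationAut (ρ : ℝ) {r : ℝ} (hr : 0 < r) : automorphismGroup (halfPlane ρ) :=
  ⟨{ toFun := dilation ρ hr
     invFun := dilation ρ (inv_pos.mpr hr)
     left_inv := fun s ↦ Subtype.ext (by simp [coe_dilation, hr.ne'])
     right_inv := fun s ↦ Subtype.ext (by simp [coe_dilation, hr.ne']) },
    isHolomorphic_dilation ρ hr, isHolomorphic_dilation ρ (inv_pos.mpr hr)⟩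

theorem dilationAut_mem (ρ : ℝ) {r : ℝ} (hr : 0 < r) :
    dilationAut ρ hr ∈ linearAutomorphismGroup ρ := by
  have h : √r ≠ 0 := (Real.sqrt_pos.mpr hr).ne'
  -- Determinant one with ratio `r` of the diagonal entries forces the square roots, up to sign.
  refine ⟨⟨!![√r, 0; 0, (√r)⁻¹], by simp [Matrix.det_fin_two, h]⟩, by simp, fun s ↦ ?_⟩
  change (dilation ρ hr s : ℂ) = _
  have h1 : ((√r : ℝ) : ℂ) * ((√r : ℝ) : ℂ) = r := by
    rw [← Complex.ofReal_mul, Real.mul_self_sqrt hr.le]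
  simp [mobius, coe_dilation]
  linear_combination (ρ - (s : ℂ)) * h1

theorem IsHolomorphic.div {Ω : Set ℂ} {f g : Ω → ℂ} (hf : IsHolomorphic f) (hg : IsHolomorphic g)
    (h0 : ∀ z, g z ≠ 0) : IsHolomorphic fun z ↦ f z / g z := by
  obtain ⟨F, hF, hFf⟩ := hf
  obtain ⟨G, hG, hGg⟩ := hg
  refine ⟨fun z ↦ F z / G z, hF.div hG fun z hz ↦ ?_, fun z ↦ by simp only [hFf, hGg]⟩
  rw [hGg ⟨z, hz⟩]
  exact h0 _

/-- For nowhere-vanishing `f` the multiplier is the coboundary `f s / f (g • s)`; for `f = 0` the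
constant 1 serves. -/
theorem exists_isQuasiInvariant {Ω : Set ℂ} {κ : Ω → Ω → ℂ} {f : Ω → ℂ}
    (hf : IsHolomorphic f) (h : ∀ s u, κ s u = f s * conj (f u))
    (h0 : (∀ s, f s = 0) ∨ ∀ s, f s ≠ 0) :
    ∃ J : automorphismGroup Ω → Ω → ℂ, IsQuasiInvariant (automorphismGroup Ω) J κ := by
  rcases h0 with h0 | h0
  · exact ⟨fun _ _ ↦ 1, posSemidefKernel_of_eq_mul_conj h, fun _ _ ↦ one_ne_zero,
      fun _ ↦ ⟨fun _ ↦ 1, differentiableOn_const 1, fun _ ↦ rfl⟩, fun g s u ↦ by simp [h, h0]⟩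
  · refine ⟨fun g s ↦ f s / f (g • s), posSemidefKernel_of_eq_mul_conj h,
      fun g s ↦ div_ne_zero (h0 _) (h0 _),
      fun g ↦ hf.div (IsHolomorphic.comp (g := fun z ↦ g • z) hf g.2.1) fun z ↦ h0 _,
      fun g s u ↦ ?_⟩
    have h1 : ∀ z, conj (f z) ≠ 0 := fun z ↦ (map_ne_zero _).mpr (h0 z)
    have h2 := h0 (g • s)
    have h3 := h1 (g • u)
    rw [h, h, map_div₀]
    field_simp

theorem IsQuasiInvariant.subgroup {Ω : Set ℂ} {G : Type*} [Group G] [MulAction G Ω]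
    {J : G → Ω → ℂ} {κ : Ω → Ω → ℂ} (h : IsQuasiInvariant G J κ) (K : Subgroup G) :
    IsQuasiInvariant K (fun g ↦ J g) κ where
  posSemidef := h.posSemidef
  ne_zero g := h.ne_zero g
  holomorphic g := h.holomorphic g
  transform g := h.transform g

end DirichletKernel

end

/-! ### The equivalences and the dimension bound -/

theorem theorem4p3 (ρ : ℝ) (a : ℕ → ℕ → ℂ) (ha : DirichletKernel.IsCoefficientMatrix ρ a) :
    List.TFAE [
      ∃ J : DirichletKernel.automorphismGroup (DirichletKernel.halfPlane ρ) →
          DirichletKernel.halfPlane ρ → ℂ,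
        DirichletKernel.IsQuasiInvariant
          (DirichletKernel.automorphismGroup (DirichletKernel.halfPlane ρ)) J
          (DirichletKernel.kernel ρ a),
      ∃ J : DirichletKernel.linearAutomorphismGroup ρ → DirichletKernel.halfPlane ρ → ℂ,
        DirichletKernel.IsQuasiInvariant
          (DirichletKernel.linearAutomorphismGroup ρ) J (DirichletKernel.kernel ρ a),
      ∃ f : DirichletKernel.halfPlane ρ → ℂ,
        DirichletKernel.IsDirichletSeries ρ f ∧
        (∀ s u, DirichletKernel.kernel ρ a s u = f s * (starRingEnd ℂ) (f u)) ∧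
        ((∀ s, f s = 0) ∨ ∀ s, f s ≠ 0),
      ∃ h : DirichletKernel.PosSemidefKernel (DirichletKernel.kernel ρ a),
        haveI : Fact (DirichletKernel.PosSemidefKernel (DirichletKernel.kernel ρ a)) := ⟨h⟩
        (∀ f : DirichletKernel.HilbertSpace (DirichletKernel.kernel ρ a), f = 0) ∨
        ∃ f : DirichletKernel.HilbertSpace (DirichletKernel.kernel ρ a),
          DirichletKernel.IsDirichletSeries ρ f ∧ (∀ s, f s ≠ 0) ∧
          Submodule.span ℂ {f} = ⊤] ∧
    ∀ h : DirichletKernel.PosSemidefKernel (DirichletKernel.kernel ρ a),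
      haveI : Fact (DirichletKernel.PosSemidefKernel (DirichletKernel.kernel ρ a)) := ⟨h⟩
      (∃ J : DirichletKernel.automorphismGroup (DirichletKernel.halfPlane ρ) →
          DirichletKernel.halfPlane ρ → ℂ,
        DirichletKernel.IsQuasiInvariant
          (DirichletKernel.automorphismGroup (DirichletKernel.halfPlane ρ)) J
          (DirichletKernel.kernel ρ a)) →
      Module.rank ℂ (DirichletKernel.HilbertSpace (DirichletKernel.kernel ρ a)) ≤ 1 := by
  have h12 : ∀ J, DirichletKernel.IsQuasiInvariant
      (DirichletKernel.automorphismGroup (DirichletKernel.halfPlane ρ)) J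
      (DirichletKernel.kernel ρ a) → DirichletKernel.IsQuasiInvariant
      (DirichletKernel.linearAutomorphismGroup ρ) (fun g ↦ J g) (DirichletKernel.kernel ρ a) :=
    fun J hJ ↦ hJ.subgroup _
  have h23 : ∀ J, DirichletKernel.IsQuasiInvariant
      (DirichletKernel.linearAutomorphismGroup ρ) J (DirichletKernel.kernel ρ a) →
      ∃ f : DirichletKernel.halfPlane ρ → ℂ, DirichletKernel.IsDirichletSeries ρ f ∧
        (∀ s u, DirichletKernel.kernel ρ a s u = f s * (starRingEnd ℂ) (f u)) ∧
        ((∀ s, f s = 0) ∨ ∀ s, f s ≠ 0) := fun J hJ ↦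
    ha.exists_eq_mul_conj hJ.posSemidef fun r hr ↦
      ⟨J ⟨DirichletKernel.dilationAut ρ hr, DirichletKernel.dilationAut_mem ρ hr⟩,
        hJ.ne_zero _, hJ.transform _⟩
  have o : DirichletKernel.halfPlane ρ := ⟨((ρ + 1 : ℝ) : ℂ), by simp [DirichletKernel.halfPlane]⟩
  refine ⟨?_, fun h ↦ ?_⟩
  · tfae_have 1 → 2 := fun ⟨J, hJ⟩ ↦ ⟨_, h12 J hJ⟩
    tfae_have 2 → 3 := fun ⟨J, hJ⟩ ↦ h23 J hJ
    tfae_have 3 → 1 := fun ⟨f, hf, h, h0⟩ ↦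
      DirichletKernel.exists_isQuasiInvariant hf.isHolomorphic h h0
    tfae_have 3 → 4 := by
      rintro ⟨f, hf, h, h0⟩
      have hκ := DirichletKernel.posSemidefKernel_of_eq_mul_conj h
      have : Fact (DirichletKernel.PosSemidefKernel (DirichletKernel.kernel ρ a)) := ⟨hκ⟩
      refine ⟨hκ, h0.imp (fun h0 ↦ ?_) fun h0 ↦ ?_⟩
      · exact DirichletKernel.eq_zero_of_kernel_eq_zero fun s t ↦ by simp [h, h0]
      · obtain ⟨F, hF, hspan⟩ := DirichletKernel.exists_span_eq_top h (h0 o)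
        exact ⟨F, hF ▸ hf, fun s ↦ hF ▸ h0 s, hspan⟩
    tfae_have 4 → 3 := by
      rintro ⟨hκ, h⟩
      have : Fact (DirichletKernel.PosSemidefKernel (DirichletKernel.kernel ρ a)) := ⟨hκ⟩
      rcases h with h | ⟨F, hF, h0, hspan⟩
      · exact ⟨fun _ ↦ 0, DirichletKernel.isDirichletSeries_zero ρ,
          fun s u ↦ by simp [DirichletKernel.kernel_eq_zero_of_forall_eq_zero h],
          Or.inl fun _ ↦ rfl⟩
      · have hF0 : F ≠ 0 := by
          rintro rfl
          exact h0 o (by simp)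
        exact ⟨_, hF.const_mul _, DirichletKernel.kernel_eq_of_span_eq_top hspan hF0,
          Or.inr fun s ↦ mul_ne_zero (inv_ne_zero (by simpa using hF0)) (h0 s)⟩
    tfae_finish
  · have : Fact (DirichletKernel.PosSemidefKernel (DirichletKernel.kernel ρ a)) := ⟨h⟩
    rintro ⟨J, hJ⟩
    obtain ⟨f, -, hf, h0 | h0⟩ := h23 _ (h12 J hJ)
    · have h1 := DirichletKernel.eq_zero_of_kernel_eq_zero
        (κ := DirichletKernel.kernel ρ a) fun s t ↦ by simp [hf, h0]
      exact rank_le_one_iff.mpr ⟨0, fun v ↦ ⟨0, by rw [h1 v, smul_zero]⟩⟩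
    · obtain ⟨F, -, hspan⟩ := DirichletKernel.exists_span_eq_top hf (h0 o)
      exact rank_le_one_iff.mpr ⟨F, fun v ↦
        Submodule.mem_span_singleton.mp (hspan ▸ Submodule.mem_top)⟩
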